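/- Three players $1,2,3$ have initial capitals $1$, $1$ and $N-2$ units, where $N\ge 3$ is an integer. At each round one of the three pairs of players is chosen uniformly at random and a fair coin is flipped, which decides the direction in which one unit is transferred between the two players of the pair; all choices and flips are independent. When one of the players goes broke, he is eliminated and play continues in the same way with the remaining two, until one player has all $N$ units. Let $P_{1,1,N-2}(\text{player 3 goes broke first})$ be the probability that player $3$ is the first player whose capital reaches $0$. Then $$P_{1,1,N-2}(\text{player 3 goes broke first})\approx\frac1{N^3},$$ that is, there exist universal constants $c>0$ and $c'>0$ such that $$\frac{c}{N^3}\le P_{1,1,N-2}(\text{player 3 goes broke first})\le\frac{c'}{N^3}\qquad\text{for all integers } N\ge 3.$$ -/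

import Mathlib

open MeasureTheory

namespace GamblersRuin

/-- The capitals of the three players. The players `1, 2, 3` have the indices `0, 1, 2`. -/
abbrev Capitals : Type := Fin 3 → ℕ

/-- The random input of one round: a pair of players, coded by the player `k` who is not in it
(so the pair is `{k + 1, k + 2}` modulo `3`), and the outcome of a coin flip. -/
abbrev Round : Type := Fin 3 × Bool

/-- The player who sits out the round: as long as all three players are solvent this is the player
left out by the random choice of a pair; afterwards it is a player who is broke. -/
def sitsOut (s : Capitals) (k : Fin 3) : Fin 3 :=
  if s 0 = 0 then 0 else if s 1 = 0 then 1 else if s 2 = 0 then 2 else k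

/-- One unit goes from player `i` to player `j` (used for `i ≠ j` and `0 < s i`). -/
def transfer (s : Capitals) (i j : Fin 3) : Capitals :=
  Function.update (Function.update s i (s i - 1)) j (s j + 1)

/-- One round of the game: the two players other than the one who sits out bet one unit on
the coin. Nothing happens if one of these two is broke, as then a single player owns everything. -/
def playRound (s : Capitals) (r : Round) : Capitals :=
  let k := sitsOut s r.1
  if s (k + 1) = 0 ∨ s (k + 2) = 0 then s
  else if r.2 then transfer s (k + 2) (k + 1) else transfer s (k + 1) (k + 2)

/-- The capitals after `n` rounds, with initial capitals `s` and random inputs `ω`. -/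
def capitalAfter (s : Capitals) (ω : ℕ → Round) : ℕ → Capitals
  | 0 => s
  | n + 1 => playRound (capitalAfter s ω n) (ω n)

/-- The law of the random inputs: in each round the pair is uniform among the three pairs and
the coin is fair, independently of each other and of all other rounds. -/
noncomputable def inputLaw : Measure (ℕ → Round) :=
  Measure.infinitePi fun _ : ℕ => (PMF.uniformOfFintype Round).toMeasure

/-- The event that player `i` goes broke first: at some time player `i` is broke, and up to (and
including) that time no other player has been broke. -/
def BrokeFirst (s : Capitals) (i : Fin 3) : Set (ℕ → Round) :=
  {ω | ∃ n, capitalAfter s ω n i = 0 ∧ ∀ m ≤ n, ∀ j, j ≠ i → 0 < capitalAfter s ω m j}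

/-- The probability that player `i` goes broke first, with initial capitals `s`. -/
noncomputable def probBrokeFirst (s : Capitals) (i : Fin 3) : ℝ :=
  inputLaw.real (BrokeFirst s i)

end GamblersRuin

/-! Conditioning on one round shows that the probability `f` is harmonic in the capitals `(x, y,
z)`, with boundary value `1` where only `z = 0` and `0` where `x = 0` or `y = 0`. The harmonic cubic
`x y (x + y)` vanishes on the same two sides, and at `(1, 1, N - 2)` it equals `2`. So it suffices
to compare `f` with `cubic / N ^ 3` by the maximum principle: from below on the whole triangle, from
above only on `x + y ≤ (N + 1) / 2`, away from the corners where `f` jumps. On the line `x + y = (N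
+ 1) / 2`, the upper comparison comes from a harmonic quadratic barrier giving `f ≤ 4 min(x, y) /
N`. -/

namespace GamblersRuin

/-! ### Conditioning on the first round -/

/-- The input sequence that starts with the round `r` and goes on with `ω`. -/
def consInput (r : Round) (ω : ℕ → Round) : ℕ → Round
  | 0 => r
  | n + 1 => ω n

instance : IsProbabilityMeasure inputLaw := by
  unfold inputLaw; infer_instance

lemma measurable_consInput : Measurable fun p : Round × (ℕ → Round) => consInput p.1 p.2 := by
  refine measurable_pi_lambda _ fun n => ?_
  cases n with
  | zero => exact measurable_fst
  | succ n => exact (measurable_pi_apply n).comp measurable_snd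

/-- Prepending an independent round preserves the law. By uniqueness of product measures, boxes
suffice. -/
lemma map_consInput :
    ((PMF.uniformOfFintype Round).toMeasure.prod inputLaw).map
      (fun p => consInput p.1 p.2) = inputLaw := by
  classical
  set μ : Measure Round := (PMF.uniformOfFintype Round).toMeasure with hμ
  refine Measure.eq_infinitePi _ fun s t ht => ?_
  obtain ⟨n, hn⟩ : ∃ n, s ⊆ Finset.range (n + 1) :=
    ⟨s.sup id, fun i hi => Finset.mem_range.2 (Nat.lt_succ_of_le (Finset.le_sup (f := id) hi))⟩
  -- Padding with `Set.univ` turns the box into one over an initial segment, from which coordinate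
  -- `0` splits off.
  let t' : ℕ → Set Round := fun i => if i ∈ s then t i else Set.univ
  have hpi : (fun p : Round × (ℕ → Round) => consInput p.1 p.2) ⁻¹' (Set.pi s t)
      = t' 0 ×ˢ Set.pi (Finset.range n : Set ℕ) (fun i => t' (i + 1)) := by
    ext ⟨r, ω⟩
    simp only [Set.mem_preimage, Set.mem_pi, Set.mem_prod, Finset.mem_coe, Finset.mem_range]
    constructor
    · intro h
      refine ⟨?_, fun i _ => ?_⟩
      · by_cases h0 : 0 ∈ s
        · simpa [t', h0, consInput] using h 0 h0
        · simp [t', h0]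
      · by_cases hi : i + 1 ∈ s
        · simpa [t', hi, consInput] using h (i + 1) hi
        · simp [t', hi]
    · rintro ⟨h0, h1⟩ i hi
      cases i with
      | zero => simpa [t', hi, consInput] using h0
      | succ i =>
        have := h1 i (by have := Finset.mem_range.1 (hn hi); omega)
        simpa [t', hi, consInput] using this
  have hprod : ∏ i ∈ s, μ (t i) = ∏ i ∈ Finset.range (n + 1), μ (t' i) := by
    rw [← Finset.prod_subset hn]
    · exact Finset.prod_congr rfl fun i hi => by simp [t', hi]
    · intro i _ hi
      simp [t', hi]
  rw [Measure.map_apply measurable_consInput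
    (MeasurableSet.pi s.countable_toSet fun i _ => ht i), hpi, Measure.prod_prod, inputLaw,
    Measure.infinitePi_pi _ fun i _ => MeasurableSet.of_discrete, hprod,
    Finset.prod_range_succ', mul_comm]

lemma inputLaw_real_eq_average {A : Set (ℕ → Round)} (hA : MeasurableSet A) :
    inputLaw.real A = (∑ r, inputLaw.real {ω | consInput r ω ∈ A}) / 6 := by
  have h : inputLaw A = ∑ r, inputLaw {ω | consInput r ω ∈ A} * (6 : ENNReal)⁻¹ := by
    conv_lhs => rw [← map_consInput]
    rw [Measure.map_apply measurable_consInput hA,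
      Measure.prod_apply (measurable_consInput hA), lintegral_fintype]
    refine Finset.sum_congr rfl fun r _ => ?_
    rw [PMF.toMeasure_apply_singleton _ _ (measurableSet_singleton r), PMF.uniformOfFintype_apply]
    norm_num [Fintype.card_prod]
    rfl
  rw [measureReal_def, h, ENNReal.toReal_sum, Finset.sum_div]
  · refine Finset.sum_congr rfl fun r _ => ?_
    rw [ENNReal.toReal_mul, measureReal_def, div_eq_mul_inv]
    simp
  · intro r _
    exact ENNReal.mul_ne_top (measure_ne_top _ _) (by simp)

lemma measurable_capitalAfter (s : Capitals) (n : ℕ) :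
    Measurable fun ω => capitalAfter s ω n := by
  induction n with
  | zero => exact measurable_const
  | succ n ih =>
    have h : Measurable fun p : Capitals × Round => playRound p.1 p.2 :=
      measurable_from_prod_countable_left fun r => measurable_of_countable _
    exact h.comp (ih.prodMk (measurable_pi_apply n))

lemma measurableSet_brokeFirst (s : Capitals) (i : Fin 3) : MeasurableSet (BrokeFirst s i) := by
  have hm : ∀ n j, Measurable fun ω => capitalAfter s ω n j := fun n j =>
    (measurable_pi_apply j).comp (measurable_capitalAfter s n)
  have : BrokeFirst s i = ⋃ n, ({ω | capitalAfter s ω n i = 0} ∩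
      ⋂ m, ⋂ (_ : m ≤ n), ⋂ j, ⋂ (_ : j ≠ i), {ω | 0 < capitalAfter s ω m j}) := by
    ext ω
    simp [BrokeFirst]
  rw [this]
  refine .iUnion fun n => .inter (hm n i (measurableSet_singleton 0)) ?_
  exact .iInter fun m => .iInter fun _ => .iInter fun j => .iInter fun _ =>
    hm m j (measurableSet_Ioi (a := 0))

lemma capitalAfter_consInput (s : Capitals) (r : Round) (ω : ℕ → Round) (n : ℕ) :
    capitalAfter s (consInput r ω) (n + 1) = capitalAfter (playRound s r) ω n := by
  induction n with
  | zero => rfl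
  | succ n ih => rw [capitalAfter, ih]; rfl

lemma consInput_mem_brokeFirst {s : Capitals} (hs : ∀ i, 0 < s i) (i : Fin 3) (r : Round)
    (ω : ℕ → Round) :
    consInput r ω ∈ BrokeFirst s i ↔ ω ∈ BrokeFirst (playRound s r) i := by
  constructor
  · rintro ⟨n, h0, h⟩
    cases n with
    | zero => exact absurd h0 (hs i).ne'
    | succ n =>
      refine ⟨n, by rwa [capitalAfter_consInput] at h0, fun m hm j hj => ?_⟩
      simpa only [capitalAfter_consInput] using h (m + 1) (by omega) j hj
  · rintro ⟨n, h0, h⟩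
    refine ⟨n + 1, by rwa [capitalAfter_consInput], fun m hm j hj => ?_⟩
    cases m with
    | zero => exact hs j
    | succ m => simpa only [capitalAfter_consInput] using h m (by omega) j hj

lemma sum_probBrokeFirst_playRound {s : Capitals} (hs : ∀ i, 0 < s i) (i : Fin 3) :
    ∑ r, probBrokeFirst (playRound s r) i = 6 * probBrokeFirst s i := by
  simp only [probBrokeFirst]
  rw [inputLaw_real_eq_average (measurableSet_brokeFirst s i)]
  simp only [consInput_mem_brokeFirst hs, Set.ofPred_mem_eq]
  ring

lemma probBrokeFirst_nonneg (s : Capitals) (i : Fin 3) : 0 ≤ probBrokeFirst s i :=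
  measureReal_nonneg

lemma probBrokeFirst_le_one (s : Capitals) (i : Fin 3) : probBrokeFirst s i ≤ 1 :=
  measureReal_le_one

lemma probBrokeFirst_eq_one {s : Capitals} {i : Fin 3} (hi : s i = 0)
    (h : ∀ j, j ≠ i → 0 < s j) : probBrokeFirst s i = 1 := by
  have : BrokeFirst s i = Set.univ := by
    refine Set.eq_univ_of_forall fun ω => ⟨0, hi, fun m hm j hj => ?_⟩
    obtain rfl : m = 0 := by omega
    exact h j hj
  rw [probBrokeFirst, this, probReal_univ]

lemma probBrokeFirst_eq_zero {s : Capitals} {i j : Fin 3} (hij : j ≠ i) (hj : s j = 0) :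
    probBrokeFirst s i = 0 := by
  have : BrokeFirst s i = ∅ := by
    refine Set.eq_empty_of_forall_notMem fun ω => ?_
    rintro ⟨n, -, h⟩
    exact (h 0 (Nat.zero_le n) j hij).ne' hj
  rw [probBrokeFirst, this, measureReal_empty]

lemma sum_playRound (x y z : ℕ) (g : Capitals → ℝ) :
    ∑ r, g (playRound ![x + 1, y + 1, z + 1] r) =
      g ![x + 1, y + 2, z] + g ![x + 1, y, z + 2] + g ![x, y + 1, z + 2] +
        g ![x + 2, y + 1, z] + g ![x + 2, y, z + 1] + g ![x, y + 2, z + 1] := by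
  have e : ∀ a b c a' b' c' : ℕ, a = a' → b = b' → c = c' → g ![a, b, c] = g ![a', b', c'] := by
    rintro _ _ _ _ _ _ rfl rfl rfl; rfl
  have u0 : ∀ a b c d : ℕ, Function.update ![a, b, c] 0 d = ![d, b, c] := by
    intros; ext i; fin_cases i <;> rfl
  have u1 : ∀ a b c d : ℕ, Function.update ![a, b, c] 1 d = ![a, d, c] := by
    intros; ext i; fin_cases i <;> rfl
  have u2 : ∀ a b c d : ℕ, Function.update ![a, b, c] 2 d = ![a, b, d] := by
    intros; ext i; fin_cases i <;> rfl
  have h12 : (1 : Fin 3) + 1 = 2 := rfl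
  have h13 : (1 : Fin 3) + 2 = 0 := rfl
  have h21 : (2 : Fin 3) + 1 = 0 := rfl
  have h22 : (2 : Fin 3) + 2 = 1 := rfl
  simp [Fintype.sum_prod_type, Fin.sum_univ_three, playRound, sitsOut, transfer, h12, h13, h21,
    h22, u0, u1, u2]
  ring

/-! ### Maximum principle -/

/-- The maximum principle: a function that is at most its average over the next round on a set `D`
of capitals of solvent players, and is nonpositive at the other capitals of a closed region `K`
with constant total capital, is nonpositive on `K`. -/
lemma nonpos_of_le_average {N : ℕ} {K D : Set Capitals} {u : Capitals → ℝ}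
    (hK : ∀ s ∈ K, s 0 + s 1 + s 2 = N) (hpos : ∀ s ∈ D, ∀ i, 0 < s i)
    (hstep : ∀ s ∈ D, ∀ r, playRound s r ∈ K)
    (hsub : ∀ s ∈ D, 6 * u s ≤ ∑ r, u (playRound s r))
    (hbdry : ∀ s ∈ K, s ∉ D → u s ≤ 0) : ∀ s ∈ K, u s ≤ 0 := by
  by_contra! hne
  obtain ⟨s₀, hs₀K, hs₀⟩ := hne
  have hfin : K.Finite := by
    refine (Set.Finite.pi' fun _ : Fin 3 => Set.finite_Iic N).subset fun s hs i => ?_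
    have := hK s hs
    fin_cases i <;> simp <;> omega
  obtain ⟨s₁, hs₁K, hs₁⟩ := Set.exists_max_image K u hfin ⟨s₀, hs₀K⟩
  -- Among the maximizers, one with the largest `s 0` is chosen. If it lay in `D`, all its
  -- successors would be maximizers too, including one with larger `s 0`.
  obtain ⟨s, ⟨hsK, hsu⟩, hsmax⟩ := Set.exists_max_image {s ∈ K | u s = u s₁} (fun s => s 0)
    (hfin.subset (Set.sep_subset _ _)) ⟨s₁, hs₁K, rfl⟩
  have hspos : 0 < u s := hsu ▸ hs₀.trans_le (hs₁ s₀ hs₀K)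
  have hsD : s ∈ D := by
    by_contra h
    exact absurd (hbdry s hsK h) (not_le.2 hspos)
  have hle : ∀ r, u (playRound s r) ≤ u s := fun r => hsu ▸ hs₁ _ (hstep s hsD r)
  have hall : ∀ r, u (playRound s r) = u s := by
    have hsum : ∑ r : Round, (u s - u (playRound s r)) = 0 := by
      refine le_antisymm ?_ (Finset.sum_nonneg fun r _ => sub_nonneg.2 (hle r))
      have := hsub s hsD
      simp only [Finset.sum_sub_distrib, Finset.sum_const, Finset.card_univ, Fintype.card_prod,
        Fintype.card_fin, Fintype.card_bool, nsmul_eq_mul]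
      push_cast
      linarith
    intro r
    have := (Finset.sum_eq_zero_iff_of_nonneg fun r _ => sub_nonneg.2 (hle r)).1 hsum r
      (Finset.mem_univ r)
    linarith
  have hx : playRound s (2, true) 0 = s 0 + 1 := by
    simp [playRound, sitsOut, transfer, (hpos s hsD _).ne', show (2 : Fin 3) + 1 = 0 from rfl,
      show (2 : Fin 3) + 2 = 1 from rfl]
  have := hsmax (playRound s (2, true)) ⟨hstep s hsD _, (hall _).trans hsu⟩
  simp only [hx] at this
  omega

lemma exists_eq_of_pos {s : Capitals} (hs : ∀ i, 0 < s i) :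
    ∃ x y z, s = ![x + 1, y + 1, z + 1] := by
  refine ⟨s 0 - 1, s 1 - 1, s 2 - 1, ?_⟩
  have h0 := hs 0
  have h1 := hs 1
  have h2 := hs 2
  ext i
  fin_cases i <;> simp <;> omega

lemma sum_capitals_playRound {s : Capitals} (hs : ∀ i, 0 < s i) (r : Round) :
    playRound s r 0 + playRound s r 1 + playRound s r 2 = s 0 + s 1 + s 2 := by
  obtain ⟨x, y, z, rfl⟩ := exists_eq_of_pos hs
  obtain ⟨k, b⟩ := r
  fin_cases k <;> cases b <;> simp [playRound, sitsOut, transfer, Function.update] <;> omega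

/-- The maximum principle on the whole triangle of capitals with sum `N`. -/
lemma nonpos_of_le_average_of_sum_eq {N : ℕ} {u : Capitals → ℝ}
    (hsub : ∀ x y z : ℕ, x + y + z + 3 = N → 6 * u ![x + 1, y + 1, z + 1] ≤
      ∑ r, u (playRound ![x + 1, y + 1, z + 1] r))
    (hbdry : ∀ s : Capitals, s 0 + s 1 + s 2 = N → (∃ i, s i = 0) → u s ≤ 0)
    (s : Capitals) (hs : s 0 + s 1 + s 2 = N) : u s ≤ 0 := by
  refine nonpos_of_le_average (N := N) (K := {s | s 0 + s 1 + s 2 = N})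
    (D := {s | s 0 + s 1 + s 2 = N ∧ ∀ i, 0 < s i}) (fun s hs => hs) (fun s hs => hs.2)
    (fun s hs r => (sum_capitals_playRound hs.2 r).trans hs.1) ?_ ?_ s hs
  · rintro s ⟨hN, hs⟩
    obtain ⟨x, y, z, rfl⟩ := exists_eq_of_pos hs
    exact hsub x y z (by simp at hN; omega)
  · intro s hN hs
    refine hbdry s hN ?_
    by_contra! h
    exact hs ⟨hN, fun i => Nat.pos_of_ne_zero (h i)⟩

/-! ### Lower bound by the cubic -/

/-- The cubic polynomial `x y (x + y)`, which is harmonic for the game. -/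
def cubic (s : Capitals) : ℝ := (s 0 : ℝ) * s 1 * (s 0 + s 1)

lemma cubic_nonneg (s : Capitals) : 0 ≤ cubic s := by
  unfold cubic; positivity

lemma sum_cubic_playRound {s : Capitals} (hs : ∀ i, 0 < s i) :
    ∑ r, cubic (playRound s r) = 6 * cubic s := by
  obtain ⟨x, y, z, rfl⟩ := exists_eq_of_pos hs
  rw [sum_playRound]
  simp [cubic]
  ring

lemma cubic_le_probBrokeFirst {N : ℕ} (hN : 0 < N) (s : Capitals) (hs : s 0 + s 1 + s 2 = N) :
    4 / (N : ℝ) ^ 3 * cubic s ≤ probBrokeFirst s 2 := by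
  rw [← sub_nonpos]
  refine nonpos_of_le_average_of_sum_eq
    (u := fun s => 4 / (N : ℝ) ^ 3 * cubic s - probBrokeFirst s 2) ?_ ?_ s hs
  · intro x y z _
    have hpos : ∀ i, 0 < ![x + 1, y + 1, z + 1] i := by intro i; fin_cases i <;> simp
    rw [Finset.sum_sub_distrib, ← Finset.mul_sum, sum_cubic_playRound hpos,
      sum_probBrokeFirst_playRound hpos]
    linarith
  · intro s hs hi
    rcases Nat.eq_zero_or_pos (s 0) with h0 | h0
    · simp [cubic, h0, probBrokeFirst_nonneg]
    rcases Nat.eq_zero_or_pos (s 1) with h1 | h1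
    · simp [cubic, h1, probBrokeFirst_nonneg]
    have h2 : s 2 = 0 := by
      obtain ⟨i, hi⟩ := hi
      fin_cases i
      · exact absurd hi h0.ne'
      · exact absurd hi h1.ne'
      · exact hi
    rw [probBrokeFirst_eq_one h2 (by intro j hj; fin_cases j <;> simp_all), sub_nonpos,
      div_mul_eq_mul_div, div_le_one (by positivity)]
    have hR : (N : ℝ) = s 0 + s 1 := by rw [← hs, h2]; push_cast; ring
    rw [hR, cubic]
    -- This is `4ab ≤ (a + b) ^ 2` multiplied by `a + b`.
    nlinarith [mul_nonneg (add_nonneg (Nat.cast_nonneg (α := ℝ) (s 0)) (Nat.cast_nonneg (s 1)))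
      (sq_nonneg ((s 0 : ℝ) - s 1))]

/-! ### Upper bound by a quadratic barrier -/

/-- A quadratic polynomial that is harmonic for the game, for `(i, j) = (0, 1)` and `(1, 0)`. -/
def quadratic (N : ℕ) (i j : Fin 3) (s : Capitals) : ℝ :=
  ((s j : ℝ) - s 2) ^ 2 - 3 * (s i : ℝ) ^ 2 + 4 * N * s i

lemma probBrokeFirst_le_quadratic {N : ℕ} (hN : 0 < N) {i j : Fin 3}
    (hij : (i, j) = (0, 1) ∨ (i, j) = (1, 0)) (s : Capitals) (hs : s 0 + s 1 + s 2 = N) :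
    probBrokeFirst s 2 ≤ quadratic N i j s / (N : ℝ) ^ 2 := by
  rw [← sub_nonpos]
  refine nonpos_of_le_average_of_sum_eq
    (u := fun s => probBrokeFirst s 2 - quadratic N i j s / (N : ℝ) ^ 2) ?_ ?_ s hs
  · intro x y z _
    have hpos : ∀ i, 0 < ![x + 1, y + 1, z + 1] i := by intro i; fin_cases i <;> simp
    rw [Finset.sum_sub_distrib, ← Finset.sum_div, sum_probBrokeFirst_playRound hpos,
      sum_playRound]
    have : quadratic N i j ![x + 1, y + 2, z] + quadratic N i j ![x + 1, y, z + 2] +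
        quadratic N i j ![x, y + 1, z + 2] + quadratic N i j ![x + 2, y + 1, z] +
        quadratic N i j ![x + 2, y, z + 1] + quadratic N i j ![x, y + 2, z + 1] =
        6 * quadratic N i j ![x + 1, y + 1, z + 1] := by
      rcases hij with h | h <;> obtain ⟨rfl, rfl⟩ := Prod.mk.inj h <;> simp [quadratic] <;> ring
    rw [this, mul_div_assoc, mul_sub]
  · intro s hs hi
    have hR : (N : ℝ) = s i + s j + s 2 := by
      rw [← hs]
      rcases hij with h | h <;> obtain ⟨rfl, rfl⟩ := Prod.mk.inj h <;> push_cast <;> ring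
    have hi0 : (0 : ℝ) ≤ s i := Nat.cast_nonneg _
    have hj0 : (0 : ℝ) ≤ s j := Nat.cast_nonneg _
    have h20 : (0 : ℝ) ≤ s 2 := Nat.cast_nonneg _
    rw [sub_nonpos]
    by_cases h : s i = 0
    · rw [probBrokeFirst_eq_zero (j := i) ?_ h]
      · have : (0 : ℝ) ≤ ((s j : ℝ) - s 2) ^ 2 / (N : ℝ) ^ 2 := by positivity
        simpa [quadratic, h] using this
      · rcases hij with h | h <;> obtain ⟨rfl, rfl⟩ := Prod.mk.inj h <;> decide
    · refine (probBrokeFirst_le_one s 2).trans ?_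
      rw [one_le_div (by positivity), quadratic, hR]
      have : s j = 0 ∨ s 2 = 0 := by
        obtain ⟨k, hk⟩ := hi
        rcases hij with h' | h' <;> obtain ⟨rfl, rfl⟩ := Prod.mk.inj h' <;> fin_cases k <;> simp_all
      -- With `a = s i` and `b` the other nonzero term, the quadratic is `a ^ 2 + 4ab + b ^ 2 ≥ (a +
      -- b) ^ 2 = N ^ 2`.
      rcases this with h | h <;> rw [h] <;> simp only [Nat.cast_zero] <;>
        nlinarith [mul_nonneg hi0 hj0, mul_nonneg hi0 h20]

lemma probBrokeFirst_le_cubic_of_add_eq {N : ℕ} (hN : 0 < N) {s : Capitals}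
    (hs : s 0 + s 1 + s 2 = N) (h0 : 0 < s 0) (h1 : 0 < s 1) (hM : s 0 + s 1 = (N + 1) / 2) :
    probBrokeFirst s 2 ≤ 32 / (N : ℝ) ^ 3 * cubic s := by
  have key : ∀ i j : Fin 3, (i, j) = (0, 1) ∨ (i, j) = (1, 0) → 0 < s i → s i ≤ s j →
      s i + s j + s 2 = N → s i + s j = (N + 1) / 2 →
      cubic s = (s i : ℝ) * s j * (s i + s j) →
      probBrokeFirst s 2 ≤ 32 / (N : ℝ) ^ 3 * cubic s := by
    intro i j hij hi hle hsum hM hc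
    refine (probBrokeFirst_le_quadratic hN hij s hs).trans ?_
    have hNR : (0 : ℝ) < N := by exact_mod_cast hN
    have hi1 : (1 : ℝ) ≤ s i := by exact_mod_cast hi
    have hleR : (s i : ℝ) ≤ s j := by exact_mod_cast hle
    have hsumR : (s i : ℝ) + s j + s 2 = N := by exact_mod_cast hsum
    have hlow : (N : ℝ) ≤ 2 * (s i + s j) := by
      have : N ≤ 2 * (s i + s j) := by omega
      exact_mod_cast this
    have hupp : 2 * ((s i : ℝ) + s j) ≤ N + 1 := by
      have : 2 * (s i + s j) ≤ N + 1 := by omega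
      exact_mod_cast this
    have hq : quadratic N i j s ≤ 4 * N * s i := by
      -- On this line `s j - s 2` is `-s i` or `1 - s i`, according to the parity of `N`, and `s i ≥
      -- 1`.
      have : ((s j : ℝ) - s 2) ^ 2 ≤ (s i : ℝ) ^ 2 := by
        apply sq_le_sq' <;> linarith
      rw [quadratic]
      nlinarith
    have hc' : (N : ℝ) ^ 2 * s i ≤ 8 * cubic s := by
      -- Here `s j ≥ N / 4`, being the larger summand, and `s i + s j ≥ N / 2`.
      have h8 : (N : ℝ) ^ 2 ≤ 8 * (s j * (s i + s j)) := by nlinarith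
      rw [hc]
      nlinarith
    rw [div_mul_eq_mul_div, div_le_div_iff₀ (by positivity) (by positivity)]
    have h3 : quadratic N i j s * N ^ 3 ≤ 4 * N * s i * N ^ 3 := by gcongr
    have h4 : (N : ℝ) ^ 2 * (N ^ 2 * s i) ≤ N ^ 2 * (8 * cubic s) := by gcongr
    linarith
  rcases le_total (s 0) (s 1) with h | h
  · exact key 0 1 (Or.inl rfl) h0 h hs hM rfl
  · exact key 1 0 (Or.inr rfl) h1 h (by omega) (by omega) (by rw [cubic]; ring)

/-- A round changes `s 0 + s 1` by at most one, so the maximum principle applies to the truncated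
triangle with the line `s 0 + s 1 = (N + 1) / 2` as part of its boundary. -/
lemma probBrokeFirst_le_cubic {N : ℕ} (hN : 2 ≤ N) {s : Capitals}
    (hs : s 0 + s 1 + s 2 = N) (hM : s 0 + s 1 ≤ (N + 1) / 2) :
    probBrokeFirst s 2 ≤ 32 / (N : ℝ) ^ 3 * cubic s := by
  rw [← sub_nonpos]
  refine nonpos_of_le_average (N := N) (K := {s | s 0 + s 1 + s 2 = N ∧ s 0 + s 1 ≤ (N + 1) / 2})
    (D := {s | (s 0 + s 1 + s 2 = N ∧ s 0 + s 1 < (N + 1) / 2) ∧ ∀ i, 0 < s i})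
    (u := fun s => probBrokeFirst s 2 - 32 / (N : ℝ) ^ 3 * cubic s)
    (fun s hs => hs.1) (fun s hs => hs.2) ?_ ?_ ?_ s ⟨hs, hM⟩
  · rintro s ⟨⟨hs, hlt⟩, hpos⟩ r
    refine ⟨(sum_capitals_playRound hpos r).trans hs, ?_⟩
    obtain ⟨x, y, z, rfl⟩ := exists_eq_of_pos hpos
    obtain ⟨k, b⟩ := r
    simp only [Matrix.cons_val_zero, Matrix.cons_val_one] at hlt
    fin_cases k <;> cases b <;> simp [playRound, sitsOut, transfer, Function.update] <;> omega
  · rintro s ⟨-, hpos⟩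
    rw [Finset.sum_sub_distrib, ← Finset.mul_sum, sum_cubic_playRound hpos,
      sum_probBrokeFirst_playRound hpos]
    linarith
  · rintro s ⟨hs, hle⟩ hD
    rw [sub_nonpos]
    have hc : 0 ≤ 32 / (N : ℝ) ^ 3 * cubic s := mul_nonneg (by positivity) (cubic_nonneg s)
    rcases Nat.eq_zero_or_pos (s 0) with h0 | h0
    · rwa [probBrokeFirst_eq_zero (by decide) h0]
    rcases Nat.eq_zero_or_pos (s 1) with h1 | h1
    · rwa [probBrokeFirst_eq_zero (by decide) h1]
    refine probBrokeFirst_le_cubic_of_add_eq (by omega) hs h0 h1 (hle.antisymm ?_)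
    by_contra! hlt
    refine hD ⟨⟨hs, hlt⟩, fun i => ?_⟩
    fin_cases i
    · exact h0
    · exact h1
    · change 0 < s 2
      omega

end GamblersRuin

theorem mainTheorem1 :
    ∃ c c' : ℝ, 0 < c ∧ 0 < c' ∧ ∀ N : ℕ, 3 ≤ N →
      c * (1 / (N : ℝ) ^ 3) ≤ GamblersRuin.probBrokeFirst ![1, 1, N - 2] 2 ∧
        GamblersRuin.probBrokeFirst ![1, 1, N - 2] 2 ≤ c' * (1 / (N : ℝ) ^ 3) := by
  -- The constants `4` and `32` times the value `2` of the cubic at the start.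
  refine ⟨8, 64, by norm_num, by norm_num, fun N hN => ?_⟩
  have hs : (![1, 1, N - 2] : GamblersRuin.Capitals) 0 + ![1, 1, N - 2] 1 + ![1, 1, N - 2] 2
      = N := by
    simp
    omega
  have hc : GamblersRuin.cubic ![1, 1, N - 2] = 2 := by
    norm_num [GamblersRuin.cubic]
  constructor
  · have := GamblersRuin.cubic_le_probBrokeFirst (by omega) _ hs
    rw [hc] at this
    exact le_of_eq_of_le (by ring) this
  · have := GamblersRuin.probBrokeFirst_le_cubic (by omega) hs (by simp; omega)
    rw [hc] at this
    exact this.trans_eq (by ring)
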